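/- Let $d,K,n$ be integers with $d\ge 0$, $K\ge 2$, $n\ge 1$, let $p,q\in[1,\infty]$ with $\frac1p+\frac1q=1$ (so $\frac1\infty=0$), and let $\epsilon\ge 0$, $\gamma>0$, $W>0$, $\delta\in(0,1)$. Let $\mathcal D$ be a probability distribution on $\mathbb R^d\times\{1,\dots,K\}$ and let $\mathcal S=((x_1,y_1),\dots,(x_n,y_n))$ be drawn i.i.d. from $\mathcal D$. For a matrix $\mathbf W\in\mathbb R^{K\times d}$ with rows $w_1,\dots,w_K$, the linear classifier $x\mapsto \mathbf Wx$ classifies $(x,y)$ correctly if and only if $\langle w_y,x\rangle>\langle w_{y'},x\rangle$ for all $y'\ne y$; that is, $y=\arg\max_{y'}\langle w_{y'},x\rangle$, a tie counting as an error. Then, with probability at least $1-\delta$ over $\mathcal S$, for all $\mathbf W$ whose rows satisfy $\|w_k\|_p\le W$ for every $k$, $$\mathbb P_{(x,y)\sim\mathcal D}\Big\{\exists\, x'\ \text{with}\ \|x'-x\|_\infty\le\epsilon\ \text{and}\ y\neq\arg\max_{y'\in\{1,\dots,K\}}\langle w_{y'},x'\rangle\Big\}$$ $$\le \frac1n\sum_{i=1}^n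 \mathbf 1\Big(\langle w_{y_i},x_i\rangle\le\gamma+\max_{y'\ne y_i}\big(\langle w_{y'},x_i\rangle+\epsilon\|w_{y'}-w_{y_i}\|_1\big)\Big)$$ $$\quad+\frac{2WK}{\gamma}\Big[\frac{\epsilon\sqrt K\,d^{1/q}}{\sqrt n}+\frac1n\sum_{y=1}^K\mathbb E_{\sigma}\Big\|\sum_{i=1}^n\sigma_i x_i\mathbf 1(y_i=y)\Big\|_q\Big]+3\sqrt{\frac{\log(2/\delta)}{2n}},$$ where $\sigma_1,\dots,\sigma_n$ are independent uniform random signs in $\{-1,1\}$, and $\mathbb E_\sigma$ is the expectation over them with the sample fixed. -/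

import Mathlib

open MeasureTheory

noncomputable section

/-- The `ℓ_p` norm of a vector of `ℝ^d`, for `p ∈ [1, ∞]`. -/
def vecNorm {d : ℕ} (p : ENNReal) (v : Fin d → ℝ) : ℝ := ‖WithLp.toLp p v‖

/-- The expectation `𝔼_σ [F σ]` over `n` independent uniform random signs `σ_1, …, σ_n ∈ {-1, 1}`,
that is, the average of `F` over all `2 ^ n` sign vectors. -/
def rademacherExpectation (n : ℕ) (F : (Fin n → ℝ) → ℝ) : ℝ :=
  (∑ s : Fin n → Bool, F (fun i => if s i then 1 else -1)) / 2 ^ n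

/-- The score vector `z = f_M(x) = M x`, with `z_k = ⟨w_k, x⟩` for the `k`-th row `w_k` of `M`. -/
def scores {K d : ℕ} (M : Matrix (Fin K) (Fin d) ℝ) (x : Fin d → ℝ) : Fin K → ℝ :=
  M.mulVec x

/-- The score vector `z` predicts the class `y`: `y` is the argmax of `z`, without ties
(a tie counts as a wrong prediction). -/
def Predicts {K : ℕ} (z : Fin K → ℝ) (y : Fin K) : Prop :=
  ∀ y', y' ≠ y → z y' < z y

/-- The labelled points `(x, y)` that are misclassified by `x ↦ M x` after some perturbation of
`x` of size at most `ε` in the `ℓ_∞` norm (`Fin d → ℝ` carries the `ℓ_∞` distance). -/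
def advMisclassified {K d : ℕ} (ε : ℝ) (M : Matrix (Fin K) (Fin d) ℝ) :
    Set ((Fin d → ℝ) × Fin K) :=
  {z | ∃ x' ∈ Metric.closedBall z.1 ε, ¬ Predicts (scores M x') z.2}

/-- The best penalised score of a wrong class,
`max_{y' ≠ y} (⟨w_{y'}, x⟩ + ε ‖w_{y'} - w_y‖_1)`. -/
def advRunnerUp {K d : ℕ} (ε : ℝ) (M : Matrix (Fin K) (Fin d) ℝ) (x : Fin d → ℝ) (y : Fin K) : ℝ :=
  ⨆ y' : {y' : Fin K // y' ≠ y}, (scores M x y' + ε * vecNorm 1 (M y' - M y))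

open Classical in
/-- The empirical `γ`-margin term
`(1/n) ∑_i 1(⟨w_{y_i}, x_i⟩ ≤ γ + max_{y' ≠ y_i} (⟨w_{y'}, x_i⟩ + ε ‖w_{y'} - w_{y_i}‖_1))`. -/
def advMarginRisk {K d n : ℕ} (ε γ : ℝ) (M : Matrix (Fin K) (Fin d) ℝ)
    (S : Fin n → (Fin d → ℝ) × Fin K) : ℝ :=
  (1 / n) * ∑ i, if scores M (S i).1 (S i).2 ≤ γ + advRunnerUp ε M (S i).1 (S i).2 then 1 else 0

/-- The class-wise complexity
`(1/n) ∑_y 𝔼_σ ‖∑_i σ_i x_i 1(y_i = y)‖_q` of a sample. -/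
def classwiseComplexity {K d n : ℕ} (q : ENNReal) (S : Fin n → (Fin d → ℝ) × Fin K) : ℝ :=
  (1 / n) * ∑ y : Fin K, rademacherExpectation n fun σ =>
    vecNorm q (∑ i, if (S i).2 = y then σ i • (S i).1 else 0)

end

open ProbabilityTheory

lemma rademacherExpectation_mono {n : ℕ} {F G : (Fin n → ℝ) → ℝ}
    (h : ∀ σ : Fin n → ℝ, (∀ i, |σ i| = 1) → F σ ≤ G σ) :
    rademacherExpectation n F ≤ rademacherExpectation n G := by
  unfold rademacherExpectation
  gcongr with s
  exact h _ fun i => by split_ifs <;> simp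

lemma rademacherExpectation_add {n : ℕ} (F G : (Fin n → ℝ) → ℝ) :
    rademacherExpectation n (fun σ => F σ + G σ) =
      rademacherExpectation n F + rademacherExpectation n G := by
  simp only [rademacherExpectation, Finset.sum_add_distrib, add_div]

lemma rademacherExpectation_const_mul {n : ℕ} (c : ℝ) (F : (Fin n → ℝ) → ℝ) :
    rademacherExpectation n (fun σ => c * F σ) = c * rademacherExpectation n F := by
  simp only [rademacherExpectation, ← Finset.mul_sum, mul_div_assoc]

lemma rademacherExpectation_const {n : ℕ} (c : ℝ) :
    rademacherExpectation n (fun _ => c) = c := by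
  simp [rademacherExpectation]

lemma rademacherExpectation_sum {n : ℕ} {κ : Type*} (s : Finset κ) (F : κ → (Fin n → ℝ) → ℝ) :
    rademacherExpectation n (fun σ => ∑ k ∈ s, F k σ) =
      ∑ k ∈ s, rademacherExpectation n (F k) := by
  simp only [rademacherExpectation]
  rw [Finset.sum_comm, Finset.sum_div]

lemma rademacherExpectation_sub {n : ℕ} (F G : (Fin n → ℝ) → ℝ) :
    rademacherExpectation n (fun σ => F σ - G σ) =
      rademacherExpectation n F - rademacherExpectation n G := by
  simp only [rademacherExpectation, Finset.sum_sub_distrib, sub_div]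

/-- The law of independent uniform signs is invariant under flipping some of the signs. -/
lemma rademacherExpectation_flip {n : ℕ} (b : Fin n → Bool) (F : (Fin n → ℝ) → ℝ) :
    rademacherExpectation n (fun σ => F fun i => if b i then -σ i else σ i) =
      rademacherExpectation n F := by
  unfold rademacherExpectation
  congr 1
  have hinv : Function.Involutive fun (s : Fin n → Bool) i => (b i ^^ s i) := by
    intro s; funext i; simp
  rw [← Equiv.sum_comp hinv.toPerm]
  refine Finset.sum_congr rfl fun s _ => ?_
  refine congrArg F (funext fun i => ?_)
  simp only [Function.Involutive.coe_toPerm]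
  by_cases hb : b i = true <;> by_cases hs : s i = true <;> simp [hb, hs]

lemma rademacherExpectation_neg {n : ℕ} (F : (Fin n → ℝ) → ℝ) :
    rademacherExpectation n (fun σ => F fun i => -σ i) = rademacherExpectation n F := by
  simpa using rademacherExpectation_flip (fun _ => true) F

lemma rademacherExpectation_eq_half_add_flip {n : ℕ} (j : Fin n) (F : (Fin n → ℝ) → ℝ) :
    rademacherExpectation n F =
      rademacherExpectation n (fun σ => F σ + F fun i => if i = j then -σ i else σ i) / 2 := by
  have := rademacherExpectation_flip (fun i => decide (i = j)) F
  simp only [decide_eq_true_eq] at this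
  rw [rademacherExpectation_add, this]
  ring

lemma sq_rademacherExpectation_le {n : ℕ} (F : (Fin n → ℝ) → ℝ) :
    rademacherExpectation n F ^ 2 ≤ rademacherExpectation n fun σ => F σ ^ 2 := by
  set m := rademacherExpectation n F with hm
  have h0 : 0 ≤ rademacherExpectation n fun σ => (F σ - m) ^ 2 := by
    rw [← rademacherExpectation_const (n := n) 0]
    exact rademacherExpectation_mono fun σ _ => sq_nonneg _
  have h1 : (fun σ => (F σ - m) ^ 2) = fun σ => (F σ ^ 2 - 2 * m * F σ) + m ^ 2 := by
    funext σ; ring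
  rw [h1, rademacherExpectation_add, rademacherExpectation_sub, rademacherExpectation_const_mul,
    rademacherExpectation_const, ← hm] at h0
  linarith

lemma rademacherExpectation_sum_mul {n : ℕ} (a : Fin n → ℝ) :
    rademacherExpectation n (fun σ => ∑ i, σ i * a i) = 0 := by
  have h := rademacherExpectation_neg fun σ : Fin n → ℝ => ∑ i, σ i * a i
  simp only [neg_mul, Finset.sum_neg_distrib] at h
  have h2 := rademacherExpectation_const_mul (-1) fun σ : Fin n → ℝ => ∑ i, σ i * a i
  simp only [neg_mul, one_mul] at h2
  linarith

lemma rademacherExpectation_mul_coord {n : ℕ} {i j : Fin n} (hij : i ≠ j) :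
    rademacherExpectation n (fun σ => σ i * σ j) = 0 := by
  rw [rademacherExpectation_eq_half_add_flip i]
  simp [hij.symm, rademacherExpectation_const]

lemma rademacherExpectation_sq_sum_mul {n : ℕ} (a : Fin n → ℝ) :
    rademacherExpectation n (fun σ => (∑ i, σ i * a i) ^ 2) = ∑ i, a i ^ 2 := by
  have h1 : (fun σ : Fin n → ℝ => (∑ i, σ i * a i) ^ 2) =
      fun σ => ∑ i, ∑ j, (a i * a j) * (σ i * σ j) := by
    funext σ
    rw [sq, Finset.sum_mul_sum]
    exact Finset.sum_congr rfl fun i _ => Finset.sum_congr rfl fun j _ => by ring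
  rw [h1, rademacherExpectation_sum]
  refine Finset.sum_congr rfl fun i _ => ?_
  rw [rademacherExpectation_sum, Finset.sum_eq_single i]
  · rw [rademacherExpectation_const_mul]
    have : rademacherExpectation n (fun σ => σ i * σ i) = 1 := by
      refine Eq.trans (le_antisymm ?_ ?_) (rademacherExpectation_const (n := n) 1) <;>
      · refine rademacherExpectation_mono fun σ h => le_of_eq ?_
        rw [← abs_mul_abs_self, h i, one_mul]
    rw [this]; ring
  · intro j _ hj
    rw [rademacherExpectation_const_mul, rademacherExpectation_mul_coord hj.symm, mul_zero]
  · simp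

/-- Khintchine's upper bound for the first moment. -/
lemma rademacherExpectation_abs_sum_mul_le {n : ℕ} (a : Fin n → ℝ) :
    rademacherExpectation n (fun σ => |∑ i, σ i * a i|) ≤ √(∑ i, a i ^ 2) := by
  refine Real.le_sqrt_of_sq_le ?_
  rw [← rademacherExpectation_sq_sum_mul a]
  simpa only [sq_abs] using sq_rademacherExpectation_le fun σ : Fin n → ℝ => |∑ i, σ i * a i|

/-- The (unnormalised) Rademacher complexity of a family of vectors. -/
noncomputable def rademacherSup {ι : Type*} {n : ℕ} (a : ι → Fin n → ℝ) : ℝ :=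
  rademacherExpectation n fun σ => ⨆ t, ∑ i, σ i * a t i

/-- A uniformly bounded family of vectors. -/
def UniformlyBounded {ι : Type*} {n : ℕ} (a : ι → Fin n → ℝ) : Prop :=
  ∃ B, ∀ t i, |a t i| ≤ B

section RademacherSup

variable {ι : Type*} {n : ℕ} {a b : ι → Fin n → ℝ}

lemma UniformlyBounded.add (ha : UniformlyBounded a) (hb : UniformlyBounded b) :
    UniformlyBounded fun t i => a t i + b t i := by
  obtain ⟨A, hA⟩ := ha
  obtain ⟨B, hB⟩ := hb
  exact ⟨A + B, fun t i => (abs_add_le _ _).trans (add_le_add (hA t i) (hB t i))⟩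

lemma UniformlyBounded.neg (ha : UniformlyBounded a) : UniformlyBounded fun t i => -a t i := by
  obtain ⟨A, hA⟩ := ha
  exact ⟨A, fun t i => by rw [abs_neg]; exact hA t i⟩

lemma UniformlyBounded.const_mul (c : ℝ) (ha : UniformlyBounded a) :
    UniformlyBounded fun t i => c * a t i := by
  obtain ⟨A, hA⟩ := ha
  exact ⟨|c| * A, fun t i => by rw [abs_mul]; gcongr; exact hA t i⟩

lemma UniformlyBounded.max (ha : UniformlyBounded a) (hb : UniformlyBounded b) :
    UniformlyBounded fun t i => a t i ⊔ b t i := by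
  obtain ⟨A, hA⟩ := ha
  obtain ⟨B, hB⟩ := hb
  exact ⟨A ⊔ B, fun t i => abs_max_le_max_abs_abs.trans (max_le_max (hA t i) (hB t i))⟩

lemma UniformlyBounded.sum {κ : Type*} (s : Finset κ) {f : κ → ι → Fin n → ℝ}
    (hf : ∀ k ∈ s, UniformlyBounded (f k)) : UniformlyBounded fun t i => ∑ k ∈ s, f k t i := by
  classical
  induction s using Finset.induction_on with
  | empty => exact ⟨0, by simp⟩
  | insert k s hk ih =>
    simp only [Finset.sum_insert hk]
    exact (hf k (by simp)).add (ih fun j hj => hf j (by simp [hj]))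

lemma UniformlyBounded.bddAbove (ha : UniformlyBounded a) (σ : Fin n → ℝ) :
    BddAbove (Set.range fun t => ∑ i, σ i * a t i) := by
  obtain ⟨A, hA⟩ := ha
  refine ⟨∑ i, |σ i| * A, ?_⟩
  rintro _ ⟨t, rfl⟩
  refine Finset.sum_le_sum fun i _ => (le_abs_self _).trans ?_
  rw [abs_mul]
  exact mul_le_mul_of_nonneg_left (hA t i) (abs_nonneg _)

lemma ciSup_add_ciSup_le_of_abs_sub_le [Nonempty ι] {u v w : ι → ℝ}
    (hp : BddAbove (Set.range fun t => u t + w t)) (hm : BddAbove (Set.range fun t => u t - w t))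
    (h : ∀ s t, |v s - v t| ≤ |w s - w t|) :
    (⨆ t, (u t + v t)) + ⨆ t, (u t - v t) ≤ (⨆ t, (u t + w t)) + ⨆ t, (u t - w t) := by
  refine ciSup_add_ciSup_le fun s t => ?_
  have h1 := (le_abs_self _).trans (h s t)
  have a1 := le_ciSup hp s
  have a2 := le_ciSup hm t
  have a3 := le_ciSup hp t
  have a4 := le_ciSup hm s
  beta_reduce at a1 a2 a3 a4
  rcases le_total 0 (w s - w t) with h2 | h2
  · rw [abs_of_nonneg h2] at h1; linarith
  · rw [abs_of_nonpos h2] at h1; linarith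

lemma rademacherSup_le_of_abs_sub_le_single [Nonempty ι] (hb : UniformlyBounded b) (j : Fin n)
    (hne : ∀ t i, i ≠ j → a t i = b t i) (h : ∀ s t, |a s j - a t j| ≤ |b s j - b t j|) :
    rademacherSup a ≤ rademacherSup b := by
  unfold rademacherSup
  rw [rademacherExpectation_eq_half_add_flip j,
    rademacherExpectation_eq_half_add_flip j fun σ => ⨆ t, ∑ i, σ i * b t i]
  refine div_le_div_of_nonneg_right (rademacherExpectation_mono fun σ hσ => ?_) zero_le_two
  have e1 : ∀ (c : ι → Fin n → ℝ) t, ∑ i, σ i * c t i =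
      (∑ i ∈ Finset.univ.erase j, σ i * c t i) + σ j * c t j := fun c t =>
    (Finset.sum_erase_add _ _ (Finset.mem_univ j)).symm
  have e2 : ∀ (c : ι → Fin n → ℝ) t, ∑ i, (if i = j then -σ i else σ i) * c t i =
      (∑ i ∈ Finset.univ.erase j, σ i * c t i) - σ j * c t j := fun c t => by
    rw [← Finset.sum_erase_add _ _ (Finset.mem_univ j), sub_eq_add_neg]
    congr 1
    · refine Finset.sum_congr rfl fun i hi => ?_
      rw [if_neg (Finset.ne_of_mem_erase hi)]
    · simp
  have e3 : ∀ t, ∑ i ∈ Finset.univ.erase j, σ i * a t i =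
      ∑ i ∈ Finset.univ.erase j, σ i * b t i := fun t =>
    Finset.sum_congr rfl fun i hi => by rw [hne t i (Finset.ne_of_mem_erase hi)]
  have b1 := hb.bddAbove σ
  have b2 := hb.bddAbove fun i => if i = j then -σ i else σ i
  simp only [e1, e2, e3] at b1 b2 ⊢
  refine ciSup_add_ciSup_le_of_abs_sub_le b1 b2 fun s t => ?_
  rw [← mul_sub, ← mul_sub, abs_mul, abs_mul, hσ j, one_mul, one_mul]
  exact h s t

/-- Comparison principle for Rademacher complexities: contracting each coordinate of the family
does not increase the complexity. -/
lemma rademacherSup_le_of_abs_sub_le [Nonempty ι] (ha : UniformlyBounded a)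
    (hb : UniformlyBounded b) (h : ∀ s t i, |a s i - a t i| ≤ |b s i - b t i|) :
    rademacherSup a ≤ rademacherSup b := by
  classical
  obtain ⟨A, hA⟩ := ha
  obtain ⟨B, hB⟩ := hb
  have key : ∀ J : Finset (Fin n),
      rademacherSup (fun t i => if i ∈ J then a t i else b t i) ≤ rademacherSup b := by
    intro J
    induction J using Finset.induction_on with
    | empty => simp
    | insert j J hj ih =>
      refine le_trans (rademacherSup_le_of_abs_sub_le_single ⟨max A B, fun t i => ?_⟩ j
        (fun t i hi => ?_) fun s t => ?_) ih
      · split_ifs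
        · exact (hA t i).trans (le_max_left _ _)
        · exact (hB t i).trans (le_max_right _ _)
      · simp [hi]
      · simpa [hj] using h s t j
  simpa using key Finset.univ

lemma rademacherSup_add_le [Nonempty ι] (ha : UniformlyBounded a) (hb : UniformlyBounded b) :
    rademacherSup (fun t i => a t i + b t i) ≤ rademacherSup a + rademacherSup b := by
  unfold rademacherSup
  rw [← rademacherExpectation_add]
  refine rademacherExpectation_mono fun σ _ => ciSup_le fun t => ?_
  simp only [mul_add, Finset.sum_add_distrib]
  exact add_le_add (le_ciSup (ha.bddAbove σ) t) (le_ciSup (hb.bddAbove σ) t)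

lemma rademacherSup_neg (a : ι → Fin n → ℝ) :
    rademacherSup (fun t i => -a t i) = rademacherSup a := by
  unfold rademacherSup
  rw [← rademacherExpectation_neg]
  simp

lemma rademacherSup_const_mul {c : ℝ} (hc : 0 ≤ c) (a : ι → Fin n → ℝ) :
    rademacherSup (fun t i => c * a t i) = c * rademacherSup a := by
  unfold rademacherSup
  rw [← rademacherExpectation_const_mul]
  congr 1
  funext σ
  rw [Real.mul_iSup_of_nonneg hc]
  simp only [Finset.mul_sum]
  congr 1
  funext t
  exact Finset.sum_congr rfl fun i _ => by ring

lemma rademacherSup_max_le [Nonempty ι] (ha : UniformlyBounded a) (hb : UniformlyBounded b) :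
    rademacherSup (fun t i => max (a t i) (b t i)) ≤ rademacherSup a + rademacherSup b := by
  have hs : UniformlyBounded fun t i => a t i + b t i := ha.add hb
  have hd : UniformlyBounded fun t i => a t i + -b t i := ha.add hb.neg
  have hd' : UniformlyBounded fun t i => |a t i + -b t i| := by
    obtain ⟨B, hB⟩ := hd
    exact ⟨B, fun t i => by rw [abs_abs]; exact hB t i⟩
  have e : (fun t i => max (a t i) (b t i)) =
      fun t i => (1 / 2 : ℝ) * ((a t i + b t i) + |a t i + -b t i|) := by
    funext t i
    rcases le_total (a t i) (b t i) with h | h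
    · rw [max_eq_right h, abs_of_nonpos (by linarith)]; ring
    · rw [max_eq_left h, abs_of_nonneg (by linarith)]; ring
  rw [e, rademacherSup_const_mul (by norm_num)]
  have h1 := rademacherSup_add_le hs hd'
  have h2 := rademacherSup_add_le ha hb
  have h3 := rademacherSup_add_le ha hb.neg
  rw [rademacherSup_neg] at h3
  have h4 : rademacherSup (fun t i => |a t i + -b t i|) ≤
      rademacherSup fun t i => a t i + -b t i :=
    rademacherSup_le_of_abs_sub_le hd' hd fun s t i => abs_abs_sub_abs_le _ _
  linarith

lemma UniformlyBounded.sup' {κ : Type*} {s : Finset κ} (hs : s.Nonempty) {f : κ → ι → Fin n → ℝ}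
    (hf : ∀ k ∈ s, UniformlyBounded (f k)) :
    UniformlyBounded fun t i => s.sup' hs fun k => f k t i := by
  classical
  induction hs using Finset.Nonempty.cons_induction with
  | singleton k => simpa using hf k (by simp)
  | cons k s hk hs ih =>
    simp only [Finset.sup'_cons hs]
    exact (hf k (by simp)).max (ih fun j hj => hf j (by simp [hj]))

lemma rademacherSup_sup'_le [Nonempty ι] {κ : Type*} {s : Finset κ} (hs : s.Nonempty)
    {f : κ → ι → Fin n → ℝ} (hf : ∀ k ∈ s, UniformlyBounded (f k)) :
    rademacherSup (fun t i => s.sup' hs fun k => f k t i) ≤ ∑ k ∈ s, rademacherSup (f k) := by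
  classical
  induction hs using Finset.Nonempty.cons_induction with
  | singleton k => simp
  | cons k s hk hs ih =>
    have hf' : ∀ j ∈ s, UniformlyBounded (f j) := fun j hj => hf j (by simp [hj])
    simp only [Finset.sup'_cons hs, Finset.sum_cons]
    exact (rademacherSup_max_le (hf k (by simp)) (UniformlyBounded.sup' hs hf')).trans
      (add_le_add le_rfl (ih hf'))

lemma rademacherSup_sum_le [Nonempty ι] {κ : Type*} (s : Finset κ) {f : κ → ι → Fin n → ℝ}
    (hf : ∀ k ∈ s, UniformlyBounded (f k)) :
    rademacherSup (fun t i => ∑ k ∈ s, f k t i) ≤ ∑ k ∈ s, rademacherSup (f k) := by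
  classical
  induction s using Finset.induction_on with
  | empty => simp [rademacherSup, rademacherExpectation_const]
  | insert k s hk ih =>
    have hf' : ∀ j ∈ s, UniformlyBounded (f j) := fun j hj => hf j (by simp [hj])
    simp only [Finset.sum_insert hk]
    exact (rademacherSup_add_le (hf k (by simp)) (UniformlyBounded.sum s hf')).trans
      (add_le_add le_rfl (ih hf'))

lemma rademacherSup_le_of_forall [Nonempty ι] {F : (Fin n → ℝ) → ℝ}
    (h : ∀ σ t, ∑ i, σ i * a t i ≤ F σ) : rademacherSup a ≤ rademacherExpectation n F :=
  rademacherExpectation_mono fun σ _ => ciSup_le fun t => h σ t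

end RademacherSup

section McDiarmid

variable {Z : Type*} [MeasurableSpace Z]

lemma integrable_of_abs_le {Ω : Type*} [MeasurableSpace Ω] {ν : Measure Ω} [IsFiniteMeasure ν]
    {f : Ω → ℝ} (hf : Measurable f) {B : ℝ} (hB : ∀ x, |f x| ≤ B) : Integrable f ν :=
  Integrable.of_bound hf.aestronglyMeasurable B (Filter.Eventually.of_forall hB)

lemma abs_exp_mul_sub_le {x B : ℝ} (hx : |x| ≤ B) (t m : ℝ) :
    |Real.exp (t * (x - m))| ≤ Real.exp (|t| * (B + |m|)) := by
  rw [abs_of_pos (Real.exp_pos _), Real.exp_le_exp]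
  refine (le_abs_self _).trans ?_
  rw [abs_mul]
  refine mul_le_mul_of_nonneg_left ?_ (abs_nonneg t)
  exact (abs_sub _ _).trans (add_le_add_left hx _)

/-- Hoeffding's lemma for a function of bounded oscillation. -/
lemma integral_exp_mul_sub_integral_le (μ : Measure Z) [IsProbabilityMeasure μ] {h : Z → ℝ}
    (hm : Measurable h) {c : ℝ} (hc : 0 ≤ c) (hosc : ∀ z z', |h z - h z'| ≤ c) (t : ℝ) :
    ∫ z, Real.exp (t * (h z - ∫ z', h z' ∂μ)) ∂μ ≤ Real.exp ((c / 2) ^ 2 * t ^ 2 / 2) := by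
  have hne : Nonempty Z := μ.nonempty_of_neZero
  have hbdd : BddBelow (Set.range h) := by
    refine ⟨h hne.some - c, ?_⟩
    rintro _ ⟨z, rfl⟩
    have := (abs_le.1 (hosc z hne.some)).1
    linarith
  have hmem : ∀ z, h z ∈ Set.Icc (⨅ z, h z) ((⨅ z, h z) + c) := fun z => by
    refine ⟨ciInf_le hbdd z, ?_⟩
    have : h z - c ≤ ⨅ z, h z := le_ciInf fun z' => by
      have := (abs_le.1 (hosc z z')).2
      linarith
    linarith
  have := (hasSubgaussianMGF_of_mem_Icc (μ := μ) hm.aemeasurable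
    (Filter.Eventually.of_forall hmem)).mgf_le t
  simpa [mgf, abs_of_nonneg hc] using this

/-- The exponential moment bound behind McDiarmid's inequality. -/
lemma integral_exp_mul_sub_integral_pi_le (μ : Measure Z) [IsProbabilityMeasure μ] {c : ℝ}
    (hc : 0 ≤ c) (t : ℝ) {n : ℕ} {f : (Fin n → Z) → ℝ} (hm : Measurable f) {B : ℝ}
    (hB : ∀ S, |f S| ≤ B) (hf : ∀ S i z, |f (Function.update S i z) - f S| ≤ c) :
    ∫ S, Real.exp (t * (f S - ∫ S', f S' ∂Measure.pi fun _ => μ)) ∂(Measure.pi fun _ => μ) ≤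
      Real.exp (n * (c / 2) ^ 2 * t ^ 2 / 2) := by
  induction n with
  | zero =>
    have e : ∀ S, f S = f default := fun S => congrArg f (Subsingleton.elim _ _)
    simp [e]
  | succ n ih =>
    set ν : Measure (Fin n → Z) := Measure.pi fun _ => μ with hν
    set e := MeasurableEquiv.piFinSuccAbove (fun _ : Fin (n + 1) => Z) 0
    have hmp : MeasurePreserving e.symm (μ.prod ν) (Measure.pi fun _ => μ) :=
      (measurePreserving_piFinSuccAbove (fun _ : Fin (n + 1) => μ) 0).symm e
    have he : ∀ p, e.symm p = (Fin.cons p.1 p.2 : Fin (n + 1) → Z) := fun p => by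
      change (Fin.insertNth 0 p.1 p.2 : Fin (n + 1) → Z) = _
      simp
    have hcm : Measurable fun p : Z × (Fin n → Z) => f (Fin.cons p.1 p.2) := by
      simpa only [Function.comp_def, he] using hm.comp e.symm.measurable
    set g : (Fin n → Z) → ℝ := fun S => ∫ z, f (Fin.cons z S) ∂μ with hg
    have hint : ∀ S, Integrable (fun z => f (Fin.cons z S)) μ := fun S =>
      integrable_of_abs_le (hcm.comp measurable_prodMk_right) fun z => hB _
    have hgm : Measurable g := hcm.stronglyMeasurable.integral_prod_left'.measurable
    have hgB : ∀ S, |g S| ≤ B := fun S => by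
      have := norm_integral_le_of_norm_le_const (μ := μ) (f := fun z => f (Fin.cons z S))
        (Filter.Eventually.of_forall fun z => hB (Fin.cons z S))
      simpa using this
    have hgd : ∀ S i z, |g (Function.update S i z) - g S| ≤ c := fun S i z => by
      rw [hg]
      beta_reduce
      rw [← integral_sub (hint _) (hint _)]
      have := norm_integral_le_of_norm_le_const (μ := μ) (C := c)
        (f := fun w => f (Fin.cons w (Function.update S i z)) - f (Fin.cons w S))
        (Filter.Eventually.of_forall fun w => by
          rw [Fin.cons_update]
          exact hf _ _ _)
      simpa using this
    have hmean : ∫ S, f S ∂(Measure.pi fun _ => μ) = ∫ S, g S ∂ν := by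
      rw [← hmp.integral_comp' f]
      simp only [he]
      exact integral_prod_symm _ (integrable_of_abs_le hcm fun p => hB _)
    rw [hmean]
    set m := ∫ S, g S ∂ν with hm'
    have hexpB : ∀ p : Z × (Fin n → Z),
        |Real.exp (t * (f (Fin.cons p.1 p.2) - m))| ≤ Real.exp (|t| * (B + |m|)) := fun p => by
      exact abs_exp_mul_sub_le (hB _) _ _
    have hexpgB : ∀ S, |Real.exp (t * (g S - m))| ≤ Real.exp (|t| * (B + |m|)) := fun S => by
      exact abs_exp_mul_sub_le (hgB _) _ _
    have hexpm : Measurable fun p : Z × (Fin n → Z) =>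
        Real.exp (t * (f (Fin.cons p.1 p.2) - m)) := ((hcm.sub_const m).const_mul t).exp
    have hexpi := integrable_of_abs_le (ν := μ.prod ν) hexpm hexpB
    rw [← hmp.integral_comp' fun S => Real.exp (t * (f S - m))]
    simp only [he]
    rw [integral_prod_symm _ hexpi]
    calc ∫ S, ∫ z, Real.exp (t * (f (Fin.cons z S) - m)) ∂μ ∂ν
        ≤ ∫ S, Real.exp ((c / 2) ^ 2 * t ^ 2 / 2) * Real.exp (t * (g S - m)) ∂ν := by
          refine integral_mono hexpi.integral_prod_right
            ((integrable_of_abs_le (by fun_prop) hexpgB).const_mul _) fun S => ?_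
          have e1 : ∀ z, Real.exp (t * (f (Fin.cons z S) - m)) =
              Real.exp (t * (f (Fin.cons z S) - g S)) * Real.exp (t * (g S - m)) := fun z => by
            rw [← Real.exp_add]; congr 1; ring
          simp only [e1]
          rw [integral_mul_const]
          gcongr
          refine integral_exp_mul_sub_integral_le μ (hcm.comp measurable_prodMk_right) hc
            (fun z z' => ?_) t
          have := hf (Fin.cons z' S) 0 z
          rwa [Fin.update_cons_zero] at this
      _ ≤ Real.exp ((c / 2) ^ 2 * t ^ 2 / 2) * Real.exp (n * (c / 2) ^ 2 * t ^ 2 / 2) := by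
          rw [integral_const_mul]
          gcongr
          exact ih hgm hgB hgd
      _ = Real.exp ((n + 1 : ℕ) * (c / 2) ^ 2 * t ^ 2 / 2) := by
          rw [← Real.exp_add]
          congr 1
          push_cast
          ring

/-- **McDiarmid's inequality** for independent, identically distributed variables. -/
theorem measure_ge_le_of_bounded_differences (μ : Measure Z) [IsProbabilityMeasure μ] {c : ℝ}
    (hc : 0 ≤ c) {n : ℕ} {f : (Fin n → Z) → ℝ} (hm : Measurable f) {B : ℝ}
    (hB : ∀ S, |f S| ≤ B) (hf : ∀ S i z, |f (Function.update S i z) - f S| ≤ c)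
    {s : ℝ} (hs : 0 ≤ s) :
    (Measure.pi fun _ : Fin n => μ).real {S | s ≤ f S - ∫ S', f S' ∂Measure.pi fun _ => μ} ≤
      Real.exp (-s ^ 2 / (2 * (n * (c / 2) ^ 2))) := by
  have hsub : HasSubgaussianMGF (fun S => f S - ∫ S', f S' ∂Measure.pi fun _ => μ)
      (⟨n * (c / 2) ^ 2, by positivity⟩ : NNReal) (Measure.pi fun _ : Fin n => μ) :=
    { integrable_exp_mul := fun t => by
        refine integrable_of_abs_le (by fun_prop)
          (B := Real.exp (|t| * (B + |∫ S', f S' ∂Measure.pi fun _ => μ|))) fun S => ?_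
        exact abs_exp_mul_sub_le (hB _) _ _
      mgf_le := fun t => integral_exp_mul_sub_integral_pi_le μ hc t hm hB hf }
  exact hsub.measure_ge_le hs

end McDiarmid

section Generalization

variable {Z : Type*} {ι : Type*} {n : ℕ}

lemma abs_rademacherExpectation_le {F : (Fin n → ℝ) → ℝ} {B : ℝ}
    (h : ∀ σ : Fin n → ℝ, (∀ i, |σ i| = 1) → |F σ| ≤ B) : |rademacherExpectation n F| ≤ B := by
  rw [abs_le]
  constructor
  · exact (rademacherExpectation_const (-B)).symm.trans_le
      (rademacherExpectation_mono fun σ hσ => (abs_le.1 (h σ hσ)).1)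
  · exact (rademacherExpectation_mono fun σ hσ => (abs_le.1 (h σ hσ)).2).trans_eq
      (rademacherExpectation_const B)

lemma abs_ciSup_sub_ciSup_le [Nonempty ι] {u v : ι → ℝ} {c : ℝ} (hu : BddAbove (Set.range u))
    (hv : BddAbove (Set.range v)) (h : ∀ t, |u t - v t| ≤ c) : |(⨆ t, u t) - ⨆ t, v t| ≤ c := by
  have h1 : (⨆ t, u t) ≤ (⨆ t, v t) + c := ciSup_le fun t => by
    have := le_ciSup hv t
    have := (abs_le.1 (h t)).2
    linarith
  have h2 : (⨆ t, v t) ≤ (⨆ t, u t) + c := ciSup_le fun t => by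
    have := le_ciSup hu t
    have := (abs_le.1 (h t)).1
    linarith
  rw [abs_le]
  constructor <;> linarith

lemma abs_ciSup_le [Nonempty ι] {u : ι → ℝ} {B : ℝ} (h : ∀ t, |u t| ≤ B) : |⨆ t, u t| ≤ B := by
  have hb : BddAbove (Set.range u) := ⟨B, by rintro _ ⟨t, rfl⟩; exact (le_abs_self _).trans (h t)⟩
  rw [abs_le]
  exact ⟨(abs_le.1 (h (Classical.arbitrary ι))).1.trans (le_ciSup hb _),
    ciSup_le fun t => (abs_le.1 (h t)).2⟩

lemma bddAbove_range_of_abs_le {u : ι → ℝ} {B : ℝ} (h : ∀ t, |u t| ≤ B) :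
    BddAbove (Set.range u) :=
  ⟨B, by rintro _ ⟨t, rfl⟩; exact (le_abs_self _).trans (h t)⟩

lemma abs_sum_mul_le {σ f : Fin n → ℝ} (hσ : ∀ i, |σ i| = 1) {B : ℝ} (hf : ∀ i, |f i| ≤ B) :
    |∑ i, σ i * f i| ≤ n * B := by
  refine (Finset.abs_sum_le_sum_abs _ _).trans ?_
  refine (Finset.sum_le_card_nsmul _ _ B fun i _ => ?_).trans (by simp)
  rw [abs_mul, hσ i, one_mul]
  exact hf i

lemma sum_apply_update_sub (f : Fin n → Z → ℝ) (S : Fin n → Z) (i : Fin n) (z : Z) :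
    ∑ j, f j (Function.update S i z j) - ∑ j, f j (S j) = f i z - f i (S i) := by
  rw [← Finset.sum_sub_distrib, Finset.sum_eq_single i]
  · simp
  · intro j _ hj
    simp [Function.update_of_ne hj]
  · simp

lemma rademacherExpectation_integral {Ω : Type*} [MeasurableSpace Ω] {ν : Measure Ω}
    {F : (Fin n → ℝ) → Ω → ℝ} (hF : ∀ σ, (∀ i, |σ i| = 1) → Integrable (F σ) ν) :
    rademacherExpectation n (fun σ => ∫ x, F σ x ∂ν) =
      ∫ x, rademacherExpectation n (fun σ => F σ x) ∂ν := by
  unfold rademacherExpectation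
  rw [integral_div, integral_finsetSum]
  exact fun s _ => hF _ fun i => by split_ifs <;> simp

variable [MeasurableSpace Z]

/-- Exchanging the `i`-th points of two independent samples preserves their joint law. -/
lemma integral_prod_pi_eq_integral_exchange (μ : Measure Z) [IsProbabilityMeasure μ]
    (b : Fin n → Bool) (F : (Fin n → Z) × (Fin n → Z) → ℝ) :
    ∫ P, F (fun i => if b i then P.2 i else P.1 i, fun i => if b i then P.1 i else P.2 i)
        ∂((Measure.pi fun _ => μ).prod (Measure.pi fun _ => μ)) =
      ∫ P, F P ∂((Measure.pi fun _ => μ).prod (Measure.pi fun _ => μ)) := by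
  let sw : Fin n → Z × Z ≃ᵐ Z × Z := fun i =>
    if b i then MeasurableEquiv.prodComm else MeasurableEquiv.refl _
  have hsw : ∀ i, MeasurePreserving (sw i) (μ.prod μ) (μ.prod μ) := fun i => by
    by_cases h : b i = true
    · simp only [sw, h, if_true]
      exact Measure.measurePreserving_swap
    · simp only [sw, h]
      exact MeasurePreserving.id _
  have hz := measurePreserving_arrowProdEquivProdArrow Z Z (Fin n) (fun _ => μ) fun _ => μ
  have hpi : MeasurePreserving (MeasurableEquiv.piCongrRight sw)
      (Measure.pi fun _ => μ.prod μ) (Measure.pi fun _ => μ.prod μ) :=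
    measurePreserving_pi _ _ hsw
  rw [← hz.integral_comp' F, ← hz.integral_comp', ← hpi.integral_comp' fun Q => F _]
  refine integral_congr_ae (Filter.Eventually.of_forall fun Q => ?_)
  refine congrArg F (Prod.ext (funext fun i => ?_) (funext fun i => ?_))
  · change (if b i then (sw i (Q i)).2 else (sw i (Q i)).1) = (Q i).1
    by_cases h : b i = true
    · simp only [sw, h, if_true]; rfl
    · simp [sw, h]
  · change (if b i then (sw i (Q i)).1 else (sw i (Q i)).2) = (Q i).2
    by_cases h : b i = true
    · simp only [sw, h, if_true]; rfl
    · simp [sw, h]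

variable [Countable ι] {g : ι → Z → ℝ}

lemma measurable_ciSup_sum_mul (hgm : ∀ t, Measurable (g t)) (σ : Fin n → ℝ) :
    Measurable fun S : Fin n → Z => ⨆ t, ∑ i, σ i * g t (S i) :=
  Measurable.iSup fun t => Finset.measurable_sum _ fun i _ =>
    ((hgm t).comp (measurable_pi_apply i)).const_mul _

omit [Countable ι] in
lemma abs_mul_integral_sub_sum_le (μ : Measure Z) [IsProbabilityMeasure μ]
    (hg : ∀ t z, |g t z| ≤ 1) (S : Fin n → Z) (t : ι) :
    |n * ∫ z, g t z ∂μ - ∑ i, g t (S i)| ≤ n * 2 := by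
  have a1 : |∫ z, g t z ∂μ| ≤ 1 := by
    have := norm_integral_le_of_norm_le_const (μ := μ) (f := g t)
      (Filter.Eventually.of_forall fun z => hg t z)
    simpa using this
  have a2 := abs_sum_mul_le (σ := fun _ => 1) (fun _ => abs_one) fun i => hg t (S i)
  simp only [one_mul] at a2
  refine (abs_sub _ _).trans ?_
  rw [abs_mul, Nat.abs_cast]
  nlinarith [mul_le_mul_of_nonneg_left a1 (Nat.cast_nonneg (α := ℝ) n)]

/-- **Symmetrization**: the expected uniform deviation of the empirical sums from their means is at
most twice the expected Rademacher complexity. -/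
lemma integral_ciSup_deviation_le [Nonempty ι] (μ : Measure Z) [IsProbabilityMeasure μ]
    (hgm : ∀ t, Measurable (g t)) (hg : ∀ t z, |g t z| ≤ 1) :
    ∫ S, ⨆ t, (n * ∫ z, g t z ∂μ - ∑ i, g t (S i)) ∂(Measure.pi fun _ : Fin n => μ) ≤
      2 * ∫ S, rademacherSup (fun t i => g t (S i)) ∂(Measure.pi fun _ : Fin n => μ) := by
  set ν : Measure (Fin n → Z) := Measure.pi fun _ => μ with hν
  set A : (Fin n → ℝ) → (Fin n → Z) → ℝ := fun σ S => ⨆ t, ∑ i, σ i * g t (S i) with hA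
  set H : (Fin n → ℝ) → (Fin n → Z) × (Fin n → Z) → ℝ := fun σ P =>
    ⨆ t, ∑ i, σ i * (g t (P.2 i) - g t (P.1 i)) with hH
  have hAm : ∀ σ, Measurable (A σ) := measurable_ciSup_sum_mul hgm
  have hAB : ∀ σ : Fin n → ℝ, (∀ i, |σ i| = 1) → ∀ S, |A σ S| ≤ n * 1 := fun σ hσ S =>
    abs_ciSup_le fun t => abs_sum_mul_le hσ fun i => hg t _
  have hAi : ∀ σ : Fin n → ℝ, (∀ i, |σ i| = 1) → Integrable (A σ) ν := fun σ hσ =>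
    integrable_of_abs_le (hAm σ) (hAB σ hσ)
  have hneg : ∀ σ : Fin n → ℝ, (∀ i, |σ i| = 1) → ∀ i, |(-σ i)| = 1 := fun σ hσ i => by
    rw [abs_neg]; exact hσ i
  have hg2 : ∀ t z z', |g t z - g t z'| ≤ 2 := fun t z z' => by
    have := abs_sub (g t z) (g t z')
    linarith [hg t z, hg t z']
  have hHm : ∀ σ, Measurable (H σ) := fun σ =>
    Measurable.iSup fun t => Finset.measurable_sum _ fun i _ =>
      (((hgm t).comp ((measurable_pi_apply i).comp measurable_snd)).sub
        ((hgm t).comp ((measurable_pi_apply i).comp measurable_fst))).const_mul _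
  have hHB' : ∀ σ : Fin n → ℝ, (∀ i, |σ i| = 1) → ∀ (P : (Fin n → Z) × (Fin n → Z)) t,
      |∑ i, σ i * (g t (P.2 i) - g t (P.1 i))| ≤ n * 2 := fun σ hσ P t =>
    abs_sum_mul_le hσ fun i => hg2 t _ _
  have hHB : ∀ σ : Fin n → ℝ, (∀ i, |σ i| = 1) → ∀ P, |H σ P| ≤ n * 2 := fun σ hσ P =>
    abs_ciSup_le (hHB' σ hσ P)
  have hHi : ∀ σ : Fin n → ℝ, (∀ i, |σ i| = 1) → Integrable (H σ) (ν.prod ν) := fun σ hσ =>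
    integrable_of_abs_le (hHm σ) (hHB σ hσ)
  have h1 : ∀ i : Fin n, |(fun _ => 1 : Fin n → ℝ) i| = 1 := fun _ => abs_one
  have hmean : ∀ t, ∀ i : Fin n, ∫ S, g t (S i) ∂ν = ∫ z, g t z ∂μ := fun t i =>
    integral_comp_eval (μ := fun _ : Fin n => μ) (hgm t).aestronglyMeasurable
  have hgi : ∀ t, ∀ i : Fin n, Integrable (fun S : Fin n → Z => g t (S i)) ν := fun t i =>
    integrable_of_abs_le ((hgm t).comp (measurable_pi_apply i)) fun S => hg t _
  have step1 : ∀ S, ⨆ t, (n * ∫ z, g t z ∂μ - ∑ i, g t (S i)) ≤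
      ∫ S', H (fun _ => 1) (S, S') ∂ν := fun S => by
    refine ciSup_le fun t => ?_
    have e : n * ∫ z, g t z ∂μ - ∑ i, g t (S i) =
        ∫ S', ∑ i, (1 : ℝ) * (g t (S' i) - g t (S i)) ∂ν := by
      simp only [one_mul]
      rw [integral_finsetSum Finset.univ 
        (f := fun i (S' : Fin n → Z) => g t (S' i) - g t (S i)) fun i _ => (hgi t i).sub (integrable_const _)]
      simp_rw [integral_sub (hgi t _) (integrable_const _), hmean]
      simp
    rw [e]
    refine integral_mono (integrable_finsetSum _ fun i _ =>
      ((hgi t i).sub (integrable_const _)).const_mul _)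
      (integrable_of_abs_le ((hHm _).comp measurable_prodMk_left) fun S' => hHB _ h1 _)
      fun S' => ?_
    exact le_ciSup (bddAbove_range_of_abs_le (hHB' _ h1 (S, S'))) t
  have step2 : ∀ σ : Fin n → ℝ, (∀ i, |σ i| = 1) →
      ∫ P, H (fun _ => 1) P ∂(ν.prod ν) = ∫ P, H σ P ∂(ν.prod ν) := fun σ hσ => by
    rw [← integral_prod_pi_eq_integral_exchange μ (fun i => decide (σ i = -1))]
    refine integral_congr_ae (Filter.Eventually.of_forall fun P => ?_)
    simp only [hH]
    refine congrArg _ (funext fun t => Finset.sum_congr rfl fun i _ => ?_)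
    rcases eq_or_eq_neg_of_abs_eq (hσ i) with h | h
    · have : (1 : ℝ) ≠ -1 := by norm_num
      simp [h, this]
    · simp [h]
  have step3 : ∀ σ : Fin n → ℝ, (∀ i, |σ i| = 1) →
      ∫ P, H σ P ∂(ν.prod ν) ≤ ∫ S, A σ S ∂ν + ∫ S, A (fun i => -σ i) S ∂ν := fun σ hσ => by
    have e1 : ∫ S, A σ S ∂ν = ∫ P, A σ P.2 ∂(ν.prod ν) := by
      simp [integral_fun_snd]
    have e2 : ∫ S, A (fun i => -σ i) S ∂ν = ∫ P, A (fun i => -σ i) P.1 ∂(ν.prod ν) := by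
      simp [integral_fun_fst]
    have i1 : Integrable (fun P : (Fin n → Z) × (Fin n → Z) => A σ P.2) (ν.prod ν) :=
      integrable_of_abs_le ((hAm _).comp measurable_snd) fun P => hAB σ hσ _
    have i2 : Integrable (fun P : (Fin n → Z) × (Fin n → Z) => A (fun i => -σ i) P.1)
        (ν.prod ν) :=
      integrable_of_abs_le ((hAm _).comp measurable_fst) fun P => hAB _ (hneg σ hσ) _
    rw [e1, e2, ← integral_add i1 i2]
    refine integral_mono (hHi σ hσ) (i1.add i2) fun P => ciSup_le fun t => ?_
    have a1 := le_ciSup (bddAbove_range_of_abs_le fun t =>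
      abs_sum_mul_le hσ fun i => hg t (P.2 i)) t
    have a2 := le_ciSup (bddAbove_range_of_abs_le fun t =>
      abs_sum_mul_le (hneg σ hσ) fun i => hg t (P.1 i)) t
    refine le_trans (le_of_eq ?_) (add_le_add a1 a2)
    rw [← Finset.sum_add_distrib]
    exact Finset.sum_congr rfl fun i _ => by ring
  calc ∫ S, ⨆ t, (n * ∫ z, g t z ∂μ - ∑ i, g t (S i)) ∂ν
      ≤ ∫ S, ∫ S', H (fun _ => 1) (S, S') ∂ν ∂ν := by
        refine integral_mono ?_ (hHi _ h1).integral_prod_left step1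
        refine integrable_of_abs_le (B := n * 2) (Measurable.iSup fun t => measurable_const.sub
          (Finset.measurable_sum _ fun i _ => (hgm t).comp (measurable_pi_apply i)))
          fun S => abs_ciSup_le (abs_mul_integral_sub_sum_le μ hg S)
    _ = ∫ P, H (fun _ => 1) P ∂(ν.prod ν) := (integral_prod _ (hHi _ h1)).symm
    _ = rademacherExpectation n fun _ => ∫ P, H (fun _ => 1) P ∂(ν.prod ν) :=
        (rademacherExpectation_const _).symm
    _ ≤ rademacherExpectation n fun σ => ∫ S, A σ S ∂ν + ∫ S, A (fun i => -σ i) S ∂ν :=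
        rademacherExpectation_mono fun σ hσ => (step2 σ hσ).trans_le (step3 σ hσ)
    _ = 2 * rademacherExpectation n fun σ => ∫ S, A σ S ∂ν := by
        rw [rademacherExpectation_add, rademacherExpectation_neg fun σ => ∫ S, A σ S ∂ν]
        ring
    _ = 2 * ∫ S, rademacherSup (fun t i => g t (S i)) ∂ν := by
        rw [rademacherExpectation_integral hAi]
        rfl

/-- **Uniform generalization bound**: with probability at least `1 - δ` over the sample, the mean of
every function of a countable family of `[0, 1]`-valued functions is at most its empirical mean plus
twice the empirical Rademacher complexity of the family plus a deviation term. -/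
theorem exists_measurableSet_forall_integral_le [Nonempty ι] (hn : 0 < n) (μ : Measure Z)
    [IsProbabilityMeasure μ] (hgm : ∀ t, Measurable (g t)) (hg0 : ∀ t z, 0 ≤ g t z)
    (hg1 : ∀ t z, g t z ≤ 1) {δ : ℝ} (hδ : δ ∈ Set.Ioo (0 : ℝ) 1) :
    ∃ E : Set (Fin n → Z), MeasurableSet E ∧ 1 - δ ≤ (Measure.pi fun _ : Fin n => μ).real E ∧
      ∀ S ∈ E, ∀ t, ∫ z, g t z ∂μ ≤ (1 / n) * ∑ i, g t (S i) +
        2 / n * rademacherSup (fun t i => g t (S i)) +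
        3 * √(Real.log (2 / δ) / (2 * n)) := by
  have hn' : (0 : ℝ) < n := Nat.cast_pos.2 hn
  have hg : ∀ t z, |g t z| ≤ 1 := fun t z => abs_le.2 ⟨by linarith [hg0 t z], hg1 t z⟩
  have hd : ∀ t z z', |g t z - g t z'| ≤ 1 := fun t z z' => abs_le.2
    ⟨by linarith [hg0 t z, hg1 t z'], by linarith [hg0 t z', hg1 t z]⟩
  set ν : Measure (Fin n → Z) := Measure.pi fun _ => μ with hν
  set Φ : (Fin n → Z) → ℝ := fun S => ⨆ t, (n * ∫ z, g t z ∂μ - ∑ i, g t (S i)) with hΦ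
  set R : (Fin n → Z) → ℝ := fun S => rademacherSup (fun t i => g t (S i)) with hR
  have hΦB' := fun S : Fin n → Z => abs_mul_integral_sub_sum_le μ hg S
  have hΦB : ∀ S, |Φ S| ≤ n * 2 := fun S => abs_ciSup_le (hΦB' S)
  have hΦm : Measurable Φ := Measurable.iSup fun t => measurable_const.sub
    (Finset.measurable_sum _ fun i _ => (hgm t).comp (measurable_pi_apply i))
  have hRm : Measurable R := (Finset.measurable_sum _ fun s _ =>
    measurable_ciSup_sum_mul hgm _).div_const _
  have hΦd : ∀ S i z, |Φ (Function.update S i z) - Φ S| ≤ 1 := fun S i z => by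
    refine abs_ciSup_sub_ciSup_le (bddAbove_range_of_abs_le (hΦB' _))
      (bddAbove_range_of_abs_le (hΦB' _)) fun t => ?_
    rw [sub_sub_sub_cancel_left, abs_sub_comm, sum_apply_update_sub fun _ => g t]
    exact hd t _ _
  have hSB : ∀ σ : Fin n → ℝ, (∀ i, |σ i| = 1) → ∀ S : Fin n → Z, ∀ t,
      |∑ i, σ i * g t (S i)| ≤ n * 1 := fun σ hσ S t => abs_sum_mul_le hσ fun i => hg t _
  have hRd : ∀ S i z, |R (Function.update S i z) - R S| ≤ 1 := fun S i z => by
    have key : ∀ σ : Fin n → ℝ, (∀ i, |σ i| = 1) →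
        |(⨆ t, ∑ j, σ j * g t (Function.update S i z j)) - ⨆ t, ∑ j, σ j * g t (S j)| ≤ 1 :=
      fun σ hσ => by
        refine abs_ciSup_sub_ciSup_le (bddAbove_range_of_abs_le (hSB σ hσ _))
          (bddAbove_range_of_abs_le (hSB σ hσ _)) fun t => ?_
        rw [sum_apply_update_sub fun j z => σ j * g t z, ← mul_sub, abs_mul, hσ i, one_mul]
        exact hd t _ _
    simp only [hR, rademacherSup]
    rw [← rademacherExpectation_sub]
    exact abs_rademacherExpectation_le key
  have hRB : ∀ S, |R S| ≤ n := fun S =>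
    abs_rademacherExpectation_le fun σ hσ => by simpa using abs_ciSup_le (hSB σ hσ S)
  set F : (Fin n → Z) → ℝ := fun S => Φ S - 2 * R S with hF
  have hFm : Measurable F := hΦm.sub (hRm.const_mul 2)
  have hFB : ∀ S, |F S| ≤ n * 4 := fun S => by
    have := abs_sub (Φ S) (2 * R S)
    rw [abs_mul, abs_two] at this
    linarith [hΦB S, hRB S]
  have hFd : ∀ S i z, |F (Function.update S i z) - F S| ≤ 3 := fun S i z => by
    have a := abs_le.1 (hΦd S i z)
    have b := abs_le.1 (hRd S i z)
    simp only [hF]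
    rw [abs_le]
    constructor <;> linarith
  have hF0 : ∫ S, F S ∂ν ≤ 0 := by
    have := integral_ciSup_deviation_le (n := n) μ hgm hg
    simp only [hF]
    rw [integral_sub (integrable_of_abs_le hΦm hΦB) ((integrable_of_abs_le hRm hRB).const_mul 2),
      integral_const_mul]
    linarith
  set L := Real.log (2 / δ) with hL
  have hLpos : 0 ≤ L := Real.log_nonneg (by
    rw [le_div_iff₀ hδ.1]; linarith [hδ.2])
  set s := 3 * √(L / (2 * n)) with hs
  have hs2 : s ^ 2 = 9 * (L / (2 * n)) := by
    rw [hs, mul_pow, Real.sq_sqrt (by positivity)]; norm_num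
  have hMcD := measure_ge_le_of_bounded_differences μ (by norm_num : (0 : ℝ) ≤ 3) hFm hFB hFd
    (s := n * s) (by positivity)
  have hexp : Real.exp (-(n * s) ^ 2 / (2 * (n * (3 / 2) ^ 2))) = δ / 2 := by
    have : -(n * s) ^ 2 / (2 * (n * (3 / 2) ^ 2)) = -L := by
      rw [mul_pow, hs2]; field_simp; norm_num; ring
    rw [this, Real.exp_neg, hL, Real.exp_log (by have := hδ.1; positivity), inv_div]
  rw [hexp] at hMcD
  have hEm : MeasurableSet {S | n * s ≤ F S - ∫ S', F S' ∂ν} :=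
    measurableSet_le measurable_const (hFm.sub_const _)
  refine ⟨{S | n * s ≤ F S - ∫ S', F S' ∂ν}ᶜ, hEm.compl, ?_, fun S hS t => ?_⟩
  · rw [probReal_compl_eq_one_sub hEm]
    linarith [hδ.1]
  · simp only [Set.mem_compl_iff, Set.mem_ofPred_eq, not_le] at hS
    have ht : n * ∫ z, g t z ∂μ - ∑ i, g t (S i) ≤ Φ S :=
      le_ciSup (bddAbove_range_of_abs_le (hΦB' S)) t
    have hfin : n * ∫ z, g t z ∂μ ≤ ∑ i, g t (S i) + 2 * R S + n * s := by
      simp only [hF] at hS hF0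
      linarith
    have e : (1 / n) * ∑ i, g t (S i) + 2 / n * R S + s =
        (∑ i, g t (S i) + 2 * R S + n * s) / n := by
      field_simp
    rw [e, le_div_iff₀ hn']
    linarith

end Generalization

section VecNorm

variable {d : ℕ}

lemma vecNorm_one (v : Fin d → ℝ) : vecNorm 1 v = ∑ i, |v i| := by
  simp [vecNorm, PiLp.norm_eq_of_L1]

lemma vecNorm_top (v : Fin d → ℝ) : vecNorm ⊤ v = ⨆ i, |v i| := by
  simp [vecNorm, PiLp.norm_eq_ciSup]

lemma vecNorm_eq_sum {p : ENNReal} (hp : 0 < p.toReal) (v : Fin d → ℝ) :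
    vecNorm p v = (∑ i, |v i| ^ p.toReal) ^ (1 / p.toReal) := by
  simp [vecNorm, PiLp.norm_eq_sum hp]

lemma vecNorm_one_nonneg (v : Fin d → ℝ) : 0 ≤ vecNorm 1 v := by
  rw [vecNorm_one]; positivity

lemma sum_mul_le_vecNorm_one_mul_top (w v : Fin d → ℝ) :
    ∑ i, w i * v i ≤ vecNorm 1 w * vecNorm ⊤ v := by
  rw [vecNorm_one, vecNorm_top, Finset.sum_mul]
  refine Finset.sum_le_sum fun i _ => ?_
  refine (le_abs_self _).trans ?_
  rw [abs_mul]
  gcongr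
  exact le_ciSup (f := fun i => |v i|) (Set.finite_range _).bddAbove i

lemma zero_lt_toReal_of_conjugate {p q : ENNReal} (hpq : 1 / p + 1 / q = 1) (hp : p ≠ ⊤) :
    0 < p.toReal := by
  refine ENNReal.toReal_pos ?_ hp
  rintro rfl
  simp at hpq

/-- **Hölder's inequality** for conjugate exponents in `[1, ∞]`. -/
lemma sum_mul_le_vecNorm_mul_vecNorm {p q : ENNReal} (hpq : 1 / p + 1 / q = 1)
    (w v : Fin d → ℝ) : ∑ i, w i * v i ≤ vecNorm p w * vecNorm q v := by
  by_cases hp : p = ⊤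
  · obtain rfl : q = 1 := by simpa [hp] using hpq
    rw [hp, mul_comm]
    simpa only [mul_comm] using sum_mul_le_vecNorm_one_mul_top v w
  by_cases hq : q = ⊤
  · obtain rfl : p = 1 := by simpa [hq] using hpq
    rw [hq]
    exact sum_mul_le_vecNorm_one_mul_top w v
  have hp0 := zero_lt_toReal_of_conjugate hpq hp
  have hq0 := zero_lt_toReal_of_conjugate ((add_comm _ _).trans hpq) hq
  have hne : ∀ {r : ENNReal}, 0 < r.toReal → 1 / r ≠ ⊤ := fun {r} hr => by
    simpa using (ENNReal.toReal_pos_iff.1 hr).1.ne'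
  have h : p.toReal.HolderConjugate q.toReal := by
    refine ⟨?_, hp0, hq0⟩
    have := congrArg ENNReal.toReal hpq
    rw [ENNReal.toReal_add (hne hp0) (hne hq0)] at this
    simpa using this
  rw [vecNorm_eq_sum hp0, vecNorm_eq_sum hq0]
  exact Real.inner_le_Lp_mul_Lq _ _ _ h

lemma vecNorm_nonneg {p q : ENNReal} (hpq : 1 / p + 1 / q = 1) (v : Fin d → ℝ) :
    0 ≤ vecNorm p v := by
  by_cases hp : p = ⊤
  · rw [hp, vecNorm_top]
    exact Real.iSup_nonneg fun i => abs_nonneg _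
  · rw [vecNorm_eq_sum (zero_lt_toReal_of_conjugate hpq hp)]
    positivity

lemma vecNorm_le_rpow_of_abs_le_one {p q : ENNReal} (hpq : 1 / p + 1 / q = 1) {v : Fin d → ℝ}
    (hv : ∀ i, |v i| ≤ 1) : vecNorm q v ≤ (d : ℝ) ^ (1 / q).toReal := by
  by_cases hq : q = ⊤
  · rw [hq, vecNorm_top]
    simpa using Real.iSup_le hv zero_le_one
  · have hq0 := zero_lt_toReal_of_conjugate ((add_comm _ _).trans hpq) hq
    rw [vecNorm_eq_sum hq0]
    have : (1 / q).toReal = 1 / q.toReal := by simp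
    rw [this]
    gcongr
    calc ∑ i, |v i| ^ q.toReal ≤ ∑ _i : Fin d, (1 : ℝ) :=
          Finset.sum_le_sum fun i _ => Real.rpow_le_one (abs_nonneg _) (hv i) hq0.le
      _ = d := by simp

lemma vecNorm_one_le_mul_vecNorm {p q : ENNReal} (hpq : 1 / p + 1 / q = 1) (w : Fin d → ℝ) :
    vecNorm 1 w ≤ vecNorm p w * (d : ℝ) ^ (1 / q).toReal := by
  have h1 : vecNorm 1 w = ∑ i, w i * (SignType.sign (w i) : ℝ) := by
    rw [vecNorm_one]
    exact Finset.sum_congr rfl fun i _ => (self_mul_sign (w i)).symm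
  rw [h1]
  refine (sum_mul_le_vecNorm_mul_vecNorm hpq _ _).trans ?_
  refine mul_le_mul_of_nonneg_left (vecNorm_le_rpow_of_abs_le_one hpq fun i => ?_)
    (vecNorm_nonneg hpq w)
  rcases lt_trichotomy (w i) 0 with h | h | h <;> simp [h]

lemma vecNorm_one_sub_le (v w : Fin d → ℝ) : vecNorm 1 (v - w) ≤ vecNorm 1 v + vecNorm 1 w := by
  simp only [vecNorm_one, ← Finset.sum_add_distrib, Pi.sub_apply]
  exact Finset.sum_le_sum fun i _ => abs_sub _ _

lemma vecNorm_one_sub_le_of_le {p q : ENNReal} (hpq : 1 / p + 1 / q = 1) {W : ℝ}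
    {v w : Fin d → ℝ} (hv : vecNorm p v ≤ W) (hw : vecNorm p w ≤ W) :
    vecNorm 1 (v - w) ≤ 2 * (W * (d : ℝ) ^ (1 / q).toReal) := by
  have h0 : (0 : ℝ) ≤ (d : ℝ) ^ (1 / q).toReal := by positivity
  have h1 := (vecNorm_one_le_mul_vecNorm hpq v).trans (mul_le_mul_of_nonneg_right hv h0)
  have h2 := (vecNorm_one_le_mul_vecNorm hpq w).trans (mul_le_mul_of_nonneg_right hw h0)
  linarith [vecNorm_one_sub_le v w]

lemma sum_mul_le_of_vecNorm_le {p q : ENNReal} (hpq : 1 / p + 1 / q = 1) {W : ℝ}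
    {w : Fin d → ℝ} (hw : vecNorm p w ≤ W) (v : Fin d → ℝ) :
    ∑ i, w i * v i ≤ W * vecNorm q v :=
  (sum_mul_le_vecNorm_mul_vecNorm hpq w v).trans
    (mul_le_mul_of_nonneg_right hw (vecNorm_nonneg ((add_comm _ _).trans hpq) v))

lemma abs_sum_mul_le_of_vecNorm_le {p q : ENNReal} (hpq : 1 / p + 1 / q = 1) {W : ℝ}
    {w : Fin d → ℝ} (hw : vecNorm p w ≤ W) (v : Fin d → ℝ) :
    |∑ i, w i * v i| ≤ W * vecNorm q v + W * vecNorm q (-v) := by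
  have hW : 0 ≤ W := (vecNorm_nonneg hpq w).trans hw
  have hqp := (add_comm _ _).trans hpq
  have h1 := sum_mul_le_of_vecNorm_le hpq hw v
  have h2 := sum_mul_le_of_vecNorm_le hpq hw (-v)
  simp only [Pi.neg_apply, mul_neg, Finset.sum_neg_distrib] at h2
  have h3 := mul_nonneg hW (vecNorm_nonneg hqp v)
  have h4 := mul_nonneg hW (vecNorm_nonneg hqp (-v))
  rw [abs_le]
  constructor <;> linarith

lemma continuous_vecNorm_one : Continuous fun v : Fin d → ℝ => vecNorm 1 v := by
  simp only [vecNorm_one]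
  fun_prop

end VecNorm

section Complexity

variable {K d n : ℕ}

/-- The margin of the label `y` in the worst case over the perturbations of `x`. -/
noncomputable def advMargin (ε : ℝ) (M : Matrix (Fin K) (Fin d) ℝ) (x : Fin d → ℝ) (y : Fin K) :
    ℝ :=
  scores M x y - advRunnerUp ε M x y

lemma nonempty_ne_of_two_le (hK : 2 ≤ K) (y : Fin K) : Nonempty {y' : Fin K // y' ≠ y} := by
  have : Nontrivial (Fin K) := Fin.nontrivial_iff_two_le.2 hK
  obtain ⟨y', hy'⟩ := exists_ne y
  exact ⟨⟨y', hy'⟩⟩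

lemma scores_apply (M : Matrix (Fin K) (Fin d) ℝ) (x : Fin d → ℝ) (k : Fin K) :
    scores M x k = ∑ j, M k j * x j := rfl

/-- The part of the signed sample sum that belongs to the class `y`. -/
noncomputable def classSum (S : Fin n → (Fin d → ℝ) × Fin K) (y : Fin K) (σ : Fin n → ℝ) :
    Fin d → ℝ :=
  ∑ i, if (S i).2 = y then σ i • (S i).1 else 0

lemma sum_mul_ite_scores (M : Matrix (Fin K) (Fin d) ℝ) (S : Fin n → (Fin d → ℝ) × Fin K)
    (y k : Fin K) (σ : Fin n → ℝ) :
    ∑ i, σ i * (if (S i).2 = y then scores M (S i).1 k else 0) =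
      ∑ j, M k j * classSum S y σ j := by
  simp only [classSum, Finset.sum_apply, Finset.mul_sum]
  rw [Finset.sum_comm]
  refine Finset.sum_congr rfl fun i _ => ?_
  split_ifs
  · rw [scores_apply, Finset.mul_sum]
    exact Finset.sum_congr rfl fun j _ => by simp only [Pi.smul_apply, smul_eq_mul]; ring
  · simp

lemma uniformlyBounded_of_forall_exists {ι : Type*} {a : ι → Fin n → ℝ}
    (h : ∀ i, ∃ B, ∀ t, |a t i| ≤ B) : UniformlyBounded a := by
  choose B hB using h
  refine ⟨∑ i, |B i|, fun t i => (hB i t).trans ((le_abs_self _).trans ?_)⟩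
  exact Finset.single_le_sum (f := fun i => |B i|) (fun j _ => abs_nonneg _) (Finset.mem_univ i)

variable {ι : Type*} {p q : ENNReal} {W : ℝ} {M : ι → Matrix (Fin K) (Fin d) ℝ}

lemma uniformlyBounded_scores (hpq : 1 / p + 1 / q = 1) (hM : ∀ t k, vecNorm p (M t k) ≤ W)
    (x : Fin n → Fin d → ℝ) (k : Fin n → Fin K) :
    UniformlyBounded fun t i => scores (M t) (x i) (k i) :=
  uniformlyBounded_of_forall_exists fun _ =>
    ⟨_, fun t => abs_sum_mul_le_of_vecNorm_le hpq (hM t _) _⟩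

lemma uniformlyBounded_penalty (hpq : 1 / p + 1 / q = 1) (hM : ∀ t k, vecNorm p (M t k) ≤ W)
    (k y : Fin K) : UniformlyBounded fun t (_ : Fin n) => vecNorm 1 (M t k - M t y) :=
  ⟨_, fun t _ => (abs_of_nonneg (vecNorm_one_nonneg _)).trans_le
    (vecNorm_one_sub_le_of_le hpq (hM t k) (hM t y))⟩

lemma UniformlyBounded.ite {a : ι → Fin n → ℝ} (ha : UniformlyBounded a) (P : Fin n → Prop)
    [DecidablePred P] : UniformlyBounded fun t i => if P i then a t i else 0 := by
  obtain ⟨A, hA⟩ := ha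
  refine ⟨|A|, fun t i => ?_⟩
  beta_reduce
  split_ifs
  · exact (hA t i).trans (le_abs_self A)
  · simp

variable [Nonempty ι]

lemma rademacherSup_scores_label_le (hpq : 1 / p + 1 / q = 1)
    (hM : ∀ t k, vecNorm p (M t k) ≤ W) (S : Fin n → (Fin d → ℝ) × Fin K) :
    rademacherSup (fun t i => scores (M t) (S i).1 (S i).2) ≤
      ∑ y, W * rademacherExpectation n fun σ => vecNorm q (classSum S y σ) := by
  simp only [← rademacherExpectation_const_mul]
  rw [← rademacherExpectation_sum]
  refine rademacherSup_le_of_forall fun σ t => ?_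
  have e : ∑ i, σ i * scores (M t) (S i).1 (S i).2 =
      ∑ y, ∑ i, σ i * (if (S i).2 = y then scores (M t) (S i).1 y else 0) := by
    rw [Finset.sum_comm]
    exact Finset.sum_congr rfl fun i _ => by simp
  rw [e]
  refine Finset.sum_le_sum fun y _ => ?_
  rw [sum_mul_ite_scores]
  exact sum_mul_le_of_vecNorm_le hpq (hM t y) _

lemma rademacherSup_penalised_le (hpq : 1 / p + 1 / q = 1) {ε : ℝ} (hε : 0 ≤ ε)
    (hM : ∀ t k, vecNorm p (M t k) ≤ W) (S : Fin n → (Fin d → ℝ) × Fin K) (y k : Fin K) :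
    rademacherSup (fun t i => if (S i).2 = y then
        scores (M t) (S i).1 k + ε * vecNorm 1 (M t k - M t y) else 0) ≤
      W * rademacherExpectation n (fun σ => vecNorm q (classSum S y σ)) +
        ε * (W * (d : ℝ) ^ (1 / q).toReal) * √(∑ i, if (S i).2 = y then 1 else 0) := by
  set c : ℝ := W * (d : ℝ) ^ (1 / q).toReal with hc
  set u : Fin n → ℝ := fun i => if (S i).2 = y then 1 else 0 with hu
  have hW : 0 ≤ W := by
    obtain ⟨t⟩ := ‹Nonempty ι›
    exact (vecNorm_nonneg hpq _).trans (hM t y)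
  have hc0 : 0 ≤ c := by positivity
  have hsq : ∑ i, u i ^ 2 = ∑ i, u i := Finset.sum_congr rfl fun i _ => by
    simp only [hu]; split_ifs <;> simp
  calc _ ≤ rademacherExpectation n fun σ => W * vecNorm q (classSum S y σ) +
        (ε * c * |∑ i, σ i * u i| + ε * c * ∑ i, σ i * u i) := by
        refine rademacherSup_le_of_forall fun σ t => ?_
        set N := vecNorm 1 (M t k - M t y) with hN
        have e : ∑ i, σ i * (if (S i).2 = y then scores (M t) (S i).1 k + ε * N else 0) =
            ∑ i, σ i * (if (S i).2 = y then scores (M t) (S i).1 k else 0) +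
              ε * N * ∑ i, σ i * u i := by
          rw [Finset.mul_sum, ← Finset.sum_add_distrib]
          refine Finset.sum_congr rfl fun i _ => ?_
          simp only [hu]
          split_ifs <;> ring
        rw [e, sum_mul_ite_scores]
        refine add_le_add (sum_mul_le_of_vecNorm_le hpq (hM t k) _) ?_
        have hN2 : |N - c| ≤ c := abs_le.2
          ⟨by linarith [vecNorm_one_nonneg (M t k - M t y)],
            by linarith [vecNorm_one_sub_le_of_le hpq (hM t k) (hM t y)]⟩
        have h1 : (N - c) * ∑ i, σ i * u i ≤ c * |∑ i, σ i * u i| := by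
          refine (le_abs_self _).trans ?_
          rw [abs_mul]
          gcongr
        nlinarith [mul_le_mul_of_nonneg_left h1 hε]
    _ = W * rademacherExpectation n (fun σ => vecNorm q (classSum S y σ)) +
        ε * c * rademacherExpectation n fun σ => |∑ i, σ i * u i| := by
        rw [rademacherExpectation_add, rademacherExpectation_add, rademacherExpectation_const_mul,
          rademacherExpectation_const_mul, rademacherExpectation_const_mul,
          rademacherExpectation_sum_mul, mul_zero, add_zero]
    _ ≤ _ := by
        gcongr
        rw [← hsq]
        exact rademacherExpectation_abs_sum_mul_le u

lemma ite_advRunnerUp_eq_sup' (ε : ℝ) (M : Matrix (Fin K) (Fin d) ℝ) (x : Fin d → ℝ) (y : Fin K)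
    [Nonempty {y' : Fin K // y' ≠ y}] (P : Prop) [Decidable P] :
    (if P then advRunnerUp ε M x y else 0) =
      Finset.univ.sup' Finset.univ_nonempty fun k : {y' : Fin K // y' ≠ y} =>
        if P then scores M x k + ε * vecNorm 1 (M k - M y) else 0 := by
  rw [Finset.sup'_univ_eq_ciSup]
  split_ifs
  · rfl
  · simp

lemma sum_sqrt_card_class_le (y : Fin n → Fin K) :
    ∑ k, √(∑ i, if y i = k then 1 else 0) ≤ √(K * n) := by
  refine Real.le_sqrt_of_sq_le ?_
  refine (sq_sum_le_card_mul_sum_sq (s := Finset.univ)).trans_eq ?_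
  have : ∀ k, √(∑ i, if y i = k then (1 : ℝ) else 0) ^ 2 = ∑ i, if y i = k then (1 : ℝ) else 0 :=
    fun k => Real.sq_sqrt (Finset.sum_nonneg fun i _ => by split_ifs <;> simp)
  simp only [this]
  rw [Finset.sum_comm]
  simp

lemma rademacherSup_advRunnerUp_le (hK : 2 ≤ K) (hpq : 1 / p + 1 / q = 1) {ε : ℝ} (hε : 0 ≤ ε)
    (hM : ∀ t k, vecNorm p (M t k) ≤ W) (S : Fin n → (Fin d → ℝ) × Fin K) :
    UniformlyBounded (fun t i => advRunnerUp ε (M t) (S i).1 (S i).2) ∧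
    rademacherSup (fun t i => advRunnerUp ε (M t) (S i).1 (S i).2) ≤
      (K - 1) * (∑ y, W * rademacherExpectation n (fun σ => vecNorm q (classSum S y σ)) +
        ε * (W * (d : ℝ) ^ (1 / q).toReal) * √(K * n)) := by
  have := nonempty_ne_of_two_le hK
  have hW : 0 ≤ W := by
    obtain ⟨t⟩ := ‹Nonempty ι›
    exact (vecNorm_nonneg hpq _).trans (hM t ⟨0, by omega⟩)
  have e : (fun t i => advRunnerUp ε (M t) (S i).1 (S i).2) = fun t i =>
      ∑ y, Finset.univ.sup' Finset.univ_nonempty fun k : {y' : Fin K // y' ≠ y} =>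
        if (S i).2 = y then scores (M t) (S i).1 k + ε * vecNorm 1 (M t k - M t y) else 0 := by
    funext t i
    simp only [← ite_advRunnerUp_eq_sup']
    simp
  have hb : ∀ y (k : {y' : Fin K // y' ≠ y}), UniformlyBounded fun t i =>
      if (S i).2 = y then scores (M t) (S i).1 k + ε * vecNorm 1 (M t k - M t y) else 0 :=
    fun y k => ((uniformlyBounded_scores hpq hM _ _).add
      ((uniformlyBounded_penalty hpq hM _ _).const_mul ε)).ite _
  have hb' : ∀ y, UniformlyBounded fun t i =>
      Finset.univ.sup' Finset.univ_nonempty fun k : {y' : Fin K // y' ≠ y} =>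
        if (S i).2 = y then scores (M t) (S i).1 k + ε * vecNorm 1 (M t k - M t y) else 0 :=
    fun y => UniformlyBounded.sup' Finset.univ_nonempty fun k _ => hb y k
  rw [e]
  refine ⟨UniformlyBounded.sum _ fun y _ => hb' y, ?_⟩
  refine (rademacherSup_sum_le _ fun y _ => hb' y).trans ?_
  have hK1 : (0 : ℝ) ≤ K - 1 := by
    have : (2 : ℝ) ≤ K := by exact_mod_cast hK
    linarith
  calc _ ≤ ∑ y, (K - 1) * (W * rademacherExpectation n (fun σ => vecNorm q (classSum S y σ)) +
        ε * (W * (d : ℝ) ^ (1 / q).toReal) * √(∑ i, if (S i).2 = y then 1 else 0)) := by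
        refine Finset.sum_le_sum fun y _ => ?_
        refine (rademacherSup_sup'_le Finset.univ_nonempty fun k _ => hb y k).trans ?_
        refine (Finset.sum_le_card_nsmul _ _ _ fun (k : {y' : Fin K // y' ≠ y}) _ =>
          rademacherSup_penalised_le hpq hε hM S y k).trans_eq ?_
        rw [nsmul_eq_mul, Finset.card_univ, Fintype.card_subtype_compl, Fintype.card_fin,
          Fintype.card_subtype_eq, Nat.cast_sub (by omega), Nat.cast_one]
    _ = (K - 1) * (∑ y, W * rademacherExpectation n (fun σ => vecNorm q (classSum S y σ)) +
        ε * (W * (d : ℝ) ^ (1 / q).toReal) *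
          ∑ y, √(∑ i, if (S i).2 = y then 1 else 0)) := by
        rw [← Finset.mul_sum, Finset.sum_add_distrib, ← Finset.mul_sum, ← Finset.mul_sum]
    _ ≤ _ := by
        gcongr
        exact sum_sqrt_card_class_le fun i => (S i).2

lemma rademacherSup_advMargin_le (hK : 2 ≤ K) (hpq : 1 / p + 1 / q = 1) {ε : ℝ} (hε : 0 ≤ ε)
    (hM : ∀ t k, vecNorm p (M t k) ≤ W) (S : Fin n → (Fin d → ℝ) × Fin K) :
    UniformlyBounded (fun t i => advMargin ε (M t) (S i).1 (S i).2) ∧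
    rademacherSup (fun t i => advMargin ε (M t) (S i).1 (S i).2) ≤
      W * K * (ε * (d : ℝ) ^ (1 / q).toReal * √(K * n) +
        ∑ y, rademacherExpectation n fun σ => vecNorm q (classSum S y σ)) := by
  have hW : 0 ≤ W := by
    obtain ⟨t⟩ := ‹Nonempty ι›
    exact (vecNorm_nonneg hpq _).trans (hM t ⟨0, by omega⟩)
  obtain ⟨hb, hle⟩ := rademacherSup_advRunnerUp_le hK hpq hε hM S
  have ha := uniformlyBounded_scores hpq hM (fun i => (S i).1) fun i => (S i).2
  simp only [advMargin, sub_eq_add_neg]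
  refine ⟨ha.add hb.neg, (rademacherSup_add_le ha hb.neg).trans ?_⟩
  rw [rademacherSup_neg (fun t i => advRunnerUp ε (M t) (S i).1 (S i).2)]
  have h1 := rademacherSup_scores_label_le hpq hM S
  rw [← Finset.mul_sum] at h1 hle
  have h2 : 0 ≤ ε * (W * (d : ℝ) ^ (1 / q).toReal) * √(K * n) := by positivity
  nlinarith

end Complexity

section Ramp

/-- The ramp loss, which decreases linearly from `1` at `0` to `0` at `γ`. -/
noncomputable def ramp (γ u : ℝ) : ℝ := max 0 (min 1 (1 - γ⁻¹ * u))

lemma ramp_nonneg (γ u : ℝ) : 0 ≤ ramp γ u := le_max_left _ _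

lemma ramp_le_one (γ u : ℝ) : ramp γ u ≤ 1 := max_le zero_le_one (min_le_left _ _)

lemma abs_ramp_sub_ramp_le (γ u v : ℝ) : |ramp γ u - ramp γ v| ≤ |γ⁻¹ * u - γ⁻¹ * v| := by
  unfold ramp
  refine (abs_max_sub_max_le_max _ _ _ _).trans ?_
  refine max_le (by simp) ((abs_min_sub_min_le_max _ _ _ _).trans (max_le (by simp) ?_))
  rw [sub_sub_sub_cancel_left, abs_sub_comm]

lemma ramp_eq_one {γ u : ℝ} (hγ : 0 < γ) (hu : u ≤ 0) : ramp γ u = 1 := by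
  have : γ⁻¹ * u ≤ 0 := mul_nonpos_of_nonneg_of_nonpos (inv_pos.2 hγ).le hu
  rw [ramp, min_eq_left (by linarith), max_eq_right zero_le_one]

lemma ramp_eq_zero {γ u : ℝ} (hγ : 0 < γ) (hu : γ ≤ u) : ramp γ u = 0 := by
  have : 1 ≤ γ⁻¹ * u := by
    rw [← inv_mul_cancel₀ hγ.ne']
    exact mul_le_mul_of_nonneg_left hu (inv_pos.2 hγ).le
  rw [ramp, min_eq_right (by linarith), max_eq_left (by linarith)]

lemma continuous_ramp (γ : ℝ) : Continuous (ramp γ) := by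
  unfold ramp
  fun_prop

end Ramp

section Margin

variable {K d : ℕ}

lemma continuous_advMargin (hK : 2 ≤ K) (ε : ℝ) (y : Fin K) :
    Continuous fun P : (Fin K → Fin d → ℝ) × (Fin d → ℝ) => advMargin ε P.1 P.2 y := by
  have := nonempty_ne_of_two_le hK y
  have hs : ∀ k : Fin K, Continuous fun P : (Fin K → Fin d → ℝ) × (Fin d → ℝ) =>
      scores P.1 P.2 k := fun k => by
    change Continuous fun P : (Fin K → Fin d → ℝ) × (Fin d → ℝ) => ∑ j, P.1 k j * P.2 j
    fun_prop
  have hv : ∀ k : Fin K, Continuous fun P : (Fin K → Fin d → ℝ) × (Fin d → ℝ) =>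
      vecNorm 1 (P.1 k - P.1 y) := fun k => continuous_vecNorm_one.comp (by fun_prop)
  simp only [advMargin, advRunnerUp, ← Finset.sup'_univ_eq_ciSup]
  exact (hs y).sub (Continuous.finset_sup'_apply _ fun k _ =>
    (hs k).add (continuous_const.mul (hv k)))

lemma measurable_advMargin (hK : 2 ≤ K) (ε : ℝ) (M : Fin K → Fin d → ℝ) :
    Measurable fun z : (Fin d → ℝ) × Fin K => advMargin ε M z.1 z.2 :=
  measurable_from_prod_countable_left fun y =>
    ((continuous_advMargin hK ε y).comp (Continuous.prodMk_right M)).measurable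

/-- A point that some admissible perturbation misclassifies has a nonpositive worst-case margin. -/
lemma advMargin_nonpos_of_mem_advMisclassified {ε : ℝ} {M : Matrix (Fin K) (Fin d) ℝ}
    {z : (Fin d → ℝ) × Fin K} (hz : z ∈ advMisclassified ε M) : advMargin ε M z.1 z.2 ≤ 0 := by
  obtain ⟨x', hx', hp⟩ := hz
  simp only [Predicts, not_forall, not_lt] at hp
  obtain ⟨k, hk, hle⟩ := hp
  have hrun : scores M z.1 k + ε * vecNorm 1 (M k - M z.2) ≤ advRunnerUp ε M z.1 z.2 :=
    le_ciSup (f := fun y' : {y' : Fin K // y' ≠ z.2} =>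
      scores M z.1 y' + ε * vecNorm 1 (M y' - M z.2)) (Set.finite_range _).bddAbove ⟨k, hk⟩
  have hpert : (scores M x' k - scores M x' z.2) - (scores M z.1 k - scores M z.1 z.2) ≤
      ε * vecNorm 1 (M k - M z.2) := by
    simp only [scores_apply, ← Finset.sum_sub_distrib, vecNorm_one, Finset.mul_sum]
    refine Finset.sum_le_sum fun j _ => ?_
    have hj : |x' j - z.1 j| ≤ ε := by
      rw [← Real.dist_eq]
      exact (dist_le_pi_dist x' z.1 j).trans hx'
    calc _ = (x' j - z.1 j) * (M k - M z.2) j := by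
          simp only [Pi.sub_apply]; ring
      _ ≤ |x' j - z.1 j| * |(M k - M z.2) j| := by
          rw [← abs_mul]; exact le_abs_self _
      _ ≤ _ := by gcongr
  unfold advMargin
  linarith

lemma ramp_advMargin_sum_le {n : ℕ} {ε γ : ℝ} (hγ : 0 < γ) (M : Matrix (Fin K) (Fin d) ℝ)
    (S : Fin n → (Fin d → ℝ) × Fin K) :
    (1 / n) * ∑ i, ramp γ (advMargin ε M (S i).1 (S i).2) ≤ advMarginRisk ε γ M S := by
  unfold advMarginRisk
  gcongr with i
  split_ifs with h
  · exact ramp_le_one _ _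
  · refine (ramp_eq_zero hγ ?_).le
    unfold advMargin
    linarith

lemma measureReal_advMisclassified_le (hK : 2 ≤ K) {ε γ : ℝ} (hγ : 0 < γ)
    (D : Measure ((Fin d → ℝ) × Fin K)) [IsProbabilityMeasure D] (M : Fin K → Fin d → ℝ) :
    D.real (advMisclassified ε M) ≤ ∫ z, ramp γ (advMargin ε M z.1 z.2) ∂D := by
  have hm := measurable_advMargin hK ε M
  have hs : MeasurableSet {z : (Fin d → ℝ) × Fin K | advMargin ε M z.1 z.2 ≤ 0} :=
    measurableSet_le hm measurable_const
  calc D.real (advMisclassified ε M)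
      ≤ D.real {z | advMargin ε M z.1 z.2 ≤ 0} :=
        measureReal_mono fun z hz => advMargin_nonpos_of_mem_advMisclassified hz
    _ = ∫ z, Set.indicator {z | advMargin ε M z.1 z.2 ≤ 0} 1 z ∂D := (integral_indicator_one hs).symm
    _ ≤ ∫ z, ramp γ (advMargin ε M z.1 z.2) ∂D := by
        refine integral_mono ((integrable_const (1 : ℝ)).indicator hs)
          (integrable_of_abs_le (B := 1) ((continuous_ramp γ).measurable.comp hm) fun z => ?_)
          fun z => ?_
        · exact abs_le.2 ⟨by linarith [ramp_nonneg γ (advMargin ε M z.1 z.2)], ramp_le_one _ _⟩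
        · by_cases h : advMargin ε M z.1 z.2 ≤ 0
          · simp [Set.indicator, h, ramp_eq_one hγ h]
          · simpa [Set.indicator, h] using ramp_nonneg _ _

lemma continuous_integral_ramp_advMargin (hK : 2 ≤ K) (ε γ : ℝ)
    (D : Measure ((Fin d → ℝ) × Fin K)) [IsProbabilityMeasure D] :
    Continuous fun M : Fin K → Fin d → ℝ => ∫ z, ramp γ (advMargin ε M z.1 z.2) ∂D := by
  refine continuous_of_dominated (bound := fun _ => 1)
    (fun M => ((continuous_ramp γ).measurable.comp
      (measurable_advMargin hK ε M)).aestronglyMeasurable)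
    (fun M => Filter.Eventually.of_forall fun z => ?_) (integrable_const _)
    (Filter.Eventually.of_forall fun z => (continuous_ramp γ).comp
      ((continuous_advMargin hK ε z.2).comp (Continuous.prodMk_left z.1)))
  rw [Real.norm_eq_abs, abs_of_nonneg (ramp_nonneg _ _)]
  exact ramp_le_one _ _

lemma rademacherSup_ramp_advMargin_le {n : ℕ} (hK : 2 ≤ K) (hn : 0 < n) {p q : ENNReal}
    (hpq : 1 / p + 1 / q = 1) {ε γ W : ℝ} (hε : 0 ≤ ε) (hγ : 0 < γ) {ι : Type*} [Nonempty ι]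
    {M : ι → Matrix (Fin K) (Fin d) ℝ} (hM : ∀ t k, vecNorm p (M t k) ≤ W)
    (S : Fin n → (Fin d → ℝ) × Fin K) :
    2 / n * rademacherSup (fun t i => ramp γ (advMargin ε (M t) (S i).1 (S i).2)) ≤
      2 * W * K / γ *
        (ε * √K * (d : ℝ) ^ (1 / q).toReal / √n + classwiseComplexity q S) := by
  obtain ⟨hb, hle⟩ := rademacherSup_advMargin_le hK hpq hε hM S
  have hr : UniformlyBounded fun t i => ramp γ (advMargin ε (M t) (S i).1 (S i).2) :=
    ⟨1, fun t i => abs_le.2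
      ⟨by linarith [ramp_nonneg γ (advMargin ε (M t) (S i).1 (S i).2)], ramp_le_one _ _⟩⟩
  have h1 := rademacherSup_le_of_abs_sub_le hr (hb.const_mul γ⁻¹)
    fun s t i => abs_ramp_sub_ramp_le γ _ _
  rw [rademacherSup_const_mul (inv_pos.2 hγ).le] at h1
  have hn' : (0 : ℝ) < n := Nat.cast_pos.2 hn
  calc _ ≤ 2 / n * (γ⁻¹ * (W * K * (ε * (d : ℝ) ^ (1 / q).toReal * √(K * n) +
        ∑ y, rademacherExpectation n fun σ => vecNorm q (classSum S y σ)))) := by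
        gcongr
        exact h1.trans (mul_le_mul_of_nonneg_left hle (inv_pos.2 hγ).le)
    _ = 2 * W * K / γ * (ε * √K * (d : ℝ) ^ (1 / q).toReal / √n + (1 / n) *
        ∑ y, rademacherExpectation n fun σ => vecNorm q (classSum S y σ)) := by
        rw [Real.sqrt_mul (Nat.cast_nonneg K)]
        have e : 1 / √(n : ℝ) = √n / n := by
          rw [div_eq_div_iff (Real.sqrt_pos.2 hn').ne' hn'.ne', one_mul,
            Real.mul_self_sqrt hn'.le]
        rw [div_eq_mul_one_div _ (√(n : ℝ)), e]
        field_simp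

end Margin

theorem theorem4 {K d n : ℕ} (hK : 2 ≤ K) (hn : 0 < n)
    (D : Measure ((Fin d → ℝ) × Fin K)) [IsProbabilityMeasure D]
    (p q : ENNReal) (hpq : 1 / p + 1 / q = 1)
    (ε γ W δ : ℝ) (hε : 0 ≤ ε) (hγ : 0 < γ) (hW : 0 < W) (hδ : δ ∈ Set.Ioo (0 : ℝ) 1) :
    ∃ E : Set (Fin n → (Fin d → ℝ) × Fin K), MeasurableSet E ∧
      1 - δ ≤ (Measure.pi fun _ : Fin n => D).real E ∧
      ∀ S ∈ E, ∀ M : Matrix (Fin K) (Fin d) ℝ, (∀ k, vecNorm p (M k) ≤ W) →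
        D.real (advMisclassified ε M) ≤
          advMarginRisk ε γ M S
          + 2 * W * K / γ *
              (ε * √K * (d : ℝ) ^ (1 / q).toReal / √n + classwiseComplexity q S)
          + 3 * √(Real.log (2 / δ) / (2 * n)) := by
  let T := {M : Fin K → Fin d → ℝ // ∀ k, vecNorm p (M k) ≤ W}
  have hT : Nonempty T := by
    refine ⟨⟨0, fun k => ?_⟩⟩
    by_cases hp : p = ⊤
    · simpa [hp, vecNorm_top] using hW.le
    · have hp0 := zero_lt_toReal_of_conjugate hpq hp
      simpa [vecNorm_eq_sum hp0, Real.zero_rpow hp0.ne', Real.zero_rpow (inv_pos.2 hp0).ne']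
        using hW.le
  have hM : ∀ (t : ℕ) k, vecNorm p ((TopologicalSpace.denseSeq T t).1 k) ≤ W := fun t =>
    (TopologicalSpace.denseSeq T t).2
  obtain ⟨E, hEm, hEp, hE⟩ := exists_measurableSet_forall_integral_le hn D
    (g := fun (t : ℕ) z => ramp γ (advMargin ε (TopologicalSpace.denseSeq T t).1 z.1 z.2))
    (fun t => (continuous_ramp γ).measurable.comp (measurable_advMargin hK ε _))
    (fun t z => ramp_nonneg _ _) (fun t z => ramp_le_one _ _) hδ
  refine ⟨E, hEm, hEp, fun S hS M hMW => ?_⟩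
  have hcompl := rademacherSup_ramp_advMargin_le (ε := ε) (γ := γ) hK hn hpq hε hγ hM S
  have hall : ∀ t : T, ∫ z, ramp γ (advMargin ε t.1 z.1 z.2) ∂D ≤
      (1 / n) * ∑ i, ramp γ (advMargin ε t.1 (S i).1 (S i).2) +
        2 * W * K / γ *
          (ε * √K * (d : ℝ) ^ (1 / q).toReal / √n + classwiseComplexity q S) +
        3 * √(Real.log (2 / δ) / (2 * n)) := fun t => by
    refine (TopologicalSpace.denseRange_denseSeq T).induction_on t (isClosed_le ?_ ?_) fun j => ?_
    · exact (continuous_integral_ramp_advMargin hK ε γ D).comp continuous_subtype_val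
    · refine ((continuous_const.mul (continuous_finsetSum _ fun i _ =>
        (continuous_ramp γ).comp ?_)).add continuous_const).add continuous_const
      exact ((continuous_advMargin hK ε (S i).2).comp
        (Continuous.prodMk_left (S i).1)).comp continuous_subtype_val
    · exact (hE S hS j).trans (by gcongr)
  refine (measureReal_advMisclassified_le hK hγ D M).trans ((hall ⟨M, hMW⟩).trans ?_)
  gcongr
  exact ramp_advMargin_sum_le hγ M S
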